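/- Let $\mathscr V$ be a symmetric monoidal closed category (no limits or colimits are assumed). Let $\mathbb T=(T,\eta,\mu)$ be a $\mathscr V$-monad on a $\mathscr V$-category $\mathscr B$. Morphisms, isomorphisms and conservativity refer to underlying ordinary categories. *Definitions.* For morphisms $e:A_1\to A_2$, $m:B_1\to B_2$ of $\mathscr B$ write $e\downarrow_{\mathscr V}m$ if the commutative square with sides $\mathscr B(A_2,m)$, $\mathscr B(e,B_1)$, $\mathscr B(e,B_2)$, $\mathscr B(A_1,m)$ is a pullback in $\mathscr V$. For a class $\mathscr H$ of morphisms put $\mathscr H^{\downarrow_{\mathscr V}}=\{m : e\downarrow_{\mathscr V}m\ \forall e\in\mathscr H\}$ and $\mathscr H^{\uparrow_{\mathscr V}}=\{e : e\downarrow_{\mathscr V}m\ \forall m\in\mathscr H\}$. A pair $(\mathscr E,\mathscr M)$ of classes of morphisms is a *$\mathscr V$-factorization system* if $\mathscr E^{\downarrow_{\mathscr V}}=\mathscr M$, $\mathscr M^{\uparrow_{\mathscr V}}=\mathscr E$, and every morphism of $\mathscr B$ factors as a morphism in $\mathscr E$ followed by one in $\mathscr M$. It is *$\mathscr V$-proper*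 if $\mathscr B(A,m)$ is a monomorphism in $\mathscr V$ for all $m\in\mathscr M$ and all objects $A$, and $\mathscr B(e,A)$ is a monomorphism in $\mathscr V$ for all $e\in\mathscr E$ and all objects $A$. The morphisms in $\mathscr M$ are called *$\mathscr M$-embeddings*. Let $\Sigma_T$ be the class of morphisms $f$ of $\mathscr B$ such that $Tf$ is an isomorphism. An object $B$ is *$\mathbb T$-complete* if $\mathscr B(f,B)$ is an isomorphism in $\mathscr V$ for every $f\in\Sigma_T$, and *$\mathbb T$-separated* if $\eta_B\in\mathscr M$; $\mathscr B_{\Sigma_T}$ is the full sub-$\mathscr V$-category of $\mathbb T$-complete objects. A *$\mathbb T$-closed $\mathscr M$-embedding* is a morphism in $\Sigma_T^{\downarrow_{\mathscr V}}\cap\mathscr M$, and a morphism is *$\mathbb T$-dense* if it lies in $(\Sigma_T^{\downarrow_{\mathscr V}}\cap\mathscr M)^{\uparrow_{\mathscr V}}$. A *$\mathscr V$-reflection* $K\dashv J:\mathscr B'\hookrightarrow\mathscr B$ is a $\mathscr V$-adjunction in which $J$ is the inclusion of a replete full sub-$\mathscr V$-category. An idempotent $\mathscr V$-monad $\mathbb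 S=(S,\rho,\lambda)$ (one with $\lambda$ invertible) determines the $\mathscr V$-reflection with unit $\rho$ onto the full sub-$\mathscr V$-category of those $B$ for which $\rho_B$ is an isomorphism. An *idempotent $\mathscr V$-core* of $\mathbb T$ is an idempotent $\mathscr V$-monad $\widetilde{\mathbb T}=(\widetilde T,\rho,\lambda)$ on $\mathscr B$ with $\Sigma_{\widetilde T}=\Sigma_T$. A $\mathscr V$-adjunction $F\dashv G:\mathscr C\to\mathscr B$ *factors through* a $\mathscr V$-reflection $K\dashv J:\mathscr B'\hookrightarrow\mathscr B$ if $GC\in\mathscr B'$ for every $C\in\mathscr C$; the corestriction $G':\mathscr C\to\mathscr B'$ of $G$ then has left $\mathscr V$-adjoint $F'=FJ$, with the same unit and counit components as $F\dashv G$, and the composite of $K\dashv J$ with $F'\dashv G'$ is isomorphic to $F\dashv G$. **Theorem.** Let $(\mathscr E,\mathscr M)$ be a $\mathscr V$-proper $\mathscr V$-factorization system on $\mathscr B$, and suppose that every morphism in $\mathscr B$ factors as a $\mathbb T$-dense morphism followed by a $\mathbb T$-closed $\mathscr M$-embedding. 1. An idempotent $\mathscr V$-core of $\mathbb T$ exists.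 Moreover, for any idempotent $\mathscr V$-core $\widetilde{\mathbb T}=(\widetilde T,\rho,\lambda)$ of $\mathbb T$: 2. The $\mathscr V$-reflective subcategory of $\mathscr B$ determined by $\widetilde{\mathbb T}$ consists of exactly the $\mathbb T$-complete objects. 3. Every $\mathbb T$-complete object of $\mathscr B$ is $\mathbb T$-separated. 4. There is a unique morphism of $\mathscr V$-monads $\iota:\widetilde{\mathbb T}\to\mathbb T$, and each of its components is a $\mathbb T$-closed $\mathscr M$-embedding. 5. Each component of the unit $\rho:1_{\mathscr B}\to\widetilde T$ is a $\mathbb T$-dense morphism. 6. Every $\mathscr V$-adjunction $F\dashv G:\mathscr C\to\mathscr B$ inducing $\mathbb T$ factors through the $\mathscr V$-reflection $K\dashv J:\mathscr B_{\Sigma_T}\hookrightarrow\mathscr B$ determined by $\widetilde{\mathbb T}$, and the induced left $\mathscr V$-adjoint $F'=FJ:\mathscr B_{\Sigma_T}\to\mathscr C$ is conservative. -/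

import Mathlib

open CategoryTheory MonoidalCategory

universe w v u₁ u₂ u₃

namespace VCat

section Homs

variable {V : Type v} [Category.{w} V] [MonoidalCategory V]
variable {B : Type u₁} [EnrichedCategory V B]

/-- Morphisms of a `V`-category, that is, morphisms of its underlying ordinary category. -/
abbrev Mor (V : Type v) [Category.{w} V] [MonoidalCategory V] {B : Type u₁}
    [EnrichedCategory V B] (X Y : B) : Type w :=
  ForgetEnrichment.of V X ⟶ ForgetEnrichment.of V Y

/-- A morphism as an element `𝟙_ V ⟶ B(X, Y)` of the hom-object. -/
def el {X Y : B} (f : Mor V X Y) : 𝟙_ V ⟶ (X ⟶[V] Y) :=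
  ForgetEnrichment.homTo V f

/-- `B(f, Y) : B(X', Y) ⟶ B(X, Y)` for a morphism `f : X ⟶ X'`. -/
def homPre {X X' : B} (f : Mor V X X') (Y : B) : (X' ⟶[V] Y) ⟶ (X ⟶[V] Y) :=
  (λ_ (X' ⟶[V] Y)).inv ≫ el f ▷ (X' ⟶[V] Y) ≫ eComp V X X' Y

/-- `B(X, g) : B(X, Y) ⟶ B(X, Y')` for a morphism `g : Y ⟶ Y'`. -/
def homPost (X : B) {Y Y' : B} (g : Mor V Y Y') : (X ⟶[V] Y) ⟶ (X ⟶[V] Y') :=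
  (ρ_ (X ⟶[V] Y)).inv ≫ (X ⟶[V] Y) ◁ el g ≫ eComp V X Y Y'

lemma homPre_id (X Y : B) : homPre (𝟙 (ForgetEnrichment.of V X)) Y = 𝟙 (X ⟶[V] Y) :=
  eHomWhiskerRight_id V (ForgetEnrichment.of V X) (ForgetEnrichment.of V Y)

lemma homPost_id (X Y : B) : homPost X (𝟙 (ForgetEnrichment.of V Y)) = 𝟙 (X ⟶[V] Y) :=
  eHomWhiskerLeft_id V (ForgetEnrichment.of V X) (ForgetEnrichment.of V Y)

lemma homPre_comp {X X' X'' : B} (f : Mor V X X') (f' : Mor V X' X'') (Y : B) :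
    homPre (X := X) (X' := X'') (f ≫ f') Y = homPre f' Y ≫ homPre f Y :=
  eHomWhiskerRight_comp V f f' (ForgetEnrichment.of V Y)

lemma homPost_comp (X : B) {Y Y' Y'' : B} (g : Mor V Y Y') (g' : Mor V Y' Y'') :
    homPost X (Y := Y) (Y' := Y'') (g ≫ g') = homPost X g ≫ homPost X g' :=
  eHomWhiskerLeft_comp V (ForgetEnrichment.of V X) g g'

lemma homPost_homPre {X X' Y Y' : B} (f : Mor V X X') (g : Mor V Y Y') :
    homPost X' g ≫ homPre f Y' = homPre f Y ≫ homPost X g :=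
  eHom_whisker_exchange V f g

lemma el_comp {X Y Z : B} (f : Mor V X Y) (g : Mor V Y Z) :
    el (X := X) (Y := Z) (f ≫ g) = (λ_ (𝟙_ V)).inv ≫ (el f ⊗ₘ el g) ≫ eComp V X Y Z :=
  Category.assoc _ _ _

lemma el_homPost {X Y Y' : B} (f : Mor V X Y) (g : Mor V Y Y') :
    el f ≫ homPost X g = el (X := X) (Y := Y') (f ≫ g) := by
  rw [el_comp, homPost, rightUnitor_inv_naturality_assoc, MonoidalCategory.tensorHom_def,
    Category.assoc, unitors_inv_equal]

lemma el_homPre {X X' Y : B} (f : Mor V X X') (g : Mor V X' Y) :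
    el g ≫ homPre f Y = el (X := X) (Y := Y) (f ≫ g) := by
  rw [el_comp, homPre, leftUnitor_inv_naturality_assoc, MonoidalCategory.tensorHom_def',
    Category.assoc]

variable {C : Type u₂} [EnrichedCategory V C]

/-- The action of a `V`-functor on morphisms, that is, its underlying ordinary functor. -/
abbrev mapMor (F : EnrichedFunctor V B C) {X Y : B} (f : Mor V X Y) :
    Mor V (F.obj X) (F.obj Y) :=
  F.forget.map f

lemma el_mapMor (F : EnrichedFunctor V B C) {X Y : B} (f : Mor V X Y) :
    el (mapMor F f) = el f ≫ F.map X Y :=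
  rfl

lemma mapMor_id (F : EnrichedFunctor V B C) (X : B) :
    mapMor F (𝟙 (ForgetEnrichment.of V X)) = 𝟙 (ForgetEnrichment.of V (F.obj X)) :=
  F.forget.map_id _

lemma mapMor_comp (F : EnrichedFunctor V B C) {X Y Z : B} (f : Mor V X Y) (g : Mor V Y Z) :
    mapMor F (X := X) (Y := Z) (f ≫ g) = mapMor F f ≫ mapMor F g :=
  F.forget.map_comp f g

lemma mapMor_mapMor {D : Type u₃} [EnrichedCategory V D] (F : EnrichedFunctor V B C)
    (G : EnrichedFunctor V C D) {X Y : B} (f : Mor V X Y) :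
    mapMor G (mapMor F f) = mapMor (F.comp V G) f :=
  Category.assoc _ _ _

lemma mapMor_idFunctor {X Y : B} (f : Mor V X Y) : mapMor (EnrichedFunctor.id V B) f = f :=
  Category.comp_id _

lemma map_homPost (F : EnrichedFunctor V B C) (X : B) {Y Y' : B} (g : Mor V Y Y') :
    F.map X Y ≫ homPost (F.obj X) (mapMor F g) = homPost X g ≫ F.map X Y' := by
  simp only [homPost, Category.assoc, EnrichedFunctor.map_comp, el_mapMor]
  rw [rightUnitor_inv_naturality_assoc, MonoidalCategory.tensorHom_def,
    MonoidalCategory.whiskerLeft_comp, Category.assoc, Category.assoc,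
    ← MonoidalCategory.whisker_exchange_assoc]

lemma map_homPre (F : EnrichedFunctor V B C) {X X' : B} (f : Mor V X X') (Y : B) :
    F.map X' Y ≫ homPre (mapMor F f) (F.obj Y) = homPre f Y ≫ F.map X Y := by
  simp only [homPre, Category.assoc, EnrichedFunctor.map_comp, el_mapMor]
  rw [leftUnitor_inv_naturality_assoc, MonoidalCategory.tensorHom_def',
    MonoidalCategory.comp_whiskerRight, Category.assoc, Category.assoc,
    MonoidalCategory.whisker_exchange_assoc]

lemma comp_naturality {X₁ X₂ X₃ Y₁ Y₂ Y₃ : B} {a : Mor V X₁ X₂} {b : Mor V X₂ X₃}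
    {a' : Mor V Y₁ Y₂} {b' : Mor V Y₂ Y₃} {W : V} {p : W ⟶ (X₁ ⟶[V] Y₁)}
    {q : W ⟶ (X₂ ⟶[V] Y₂)} {r : W ⟶ (X₃ ⟶[V] Y₃)}
    (h₁ : p ≫ homPost X₁ a' = q ≫ homPre a Y₂) (h₂ : q ≫ homPost X₂ b' = r ≫ homPre b Y₃) :
    p ≫ homPost X₁ (Y := Y₁) (Y' := Y₃) (a' ≫ b') =
      r ≫ homPre (X := X₁) (X' := X₃) (a ≫ b) Y₃ := by
  rw [homPost_comp, homPre_comp, ← Category.assoc, h₁, ← Category.assoc, ← h₂, Category.assoc,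
    Category.assoc, homPost_homPre]

lemma whisker_naturality (H : EnrichedFunctor V B C) {X X' Y Y' : B} {a : Mor V X X'}
    {b : Mor V Y Y'} {U W : V} {s : U ⟶ (X ⟶[V] Y)} {t : U ⟶ (X' ⟶[V] Y')}
    (p : W ⟶ U) (h : s ≫ homPost X b = t ≫ homPre a Y')
    {l : W ⟶ (H.obj X ⟶[V] H.obj Y)} {r : W ⟶ (H.obj X' ⟶[V] H.obj Y')}
    (hl : l = p ≫ s ≫ H.map X Y) (hr : r = p ≫ t ≫ H.map X' Y') :
    l ≫ homPost (H.obj X) (mapMor H b) = r ≫ homPre (mapMor H a) (H.obj Y') := by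
  subst hl hr
  simp only [Category.assoc, map_homPost, map_homPre]
  rw [← Category.assoc s, h, Category.assoc]

lemma isIso_of_comp_eq_id {𝒞 : Type*} [Category* 𝒞] {P Q : 𝒞} {f : P ⟶ Q} {g : Q ⟶ P}
    (h : f ≫ g = 𝟙 P) (hg : IsIso g) : IsIso f := by
  rw [IsIso.eq_inv_of_inv_hom_id (f := g) h]
  infer_instance

lemma eq_of_comp_eq_id {𝒞 : Type*} [Category* 𝒞] {P Q : 𝒞} {f : P ⟶ Q} {g h : Q ⟶ P}
    (hg : g ≫ f = 𝟙 Q) (hh : f ≫ h = 𝟙 P) : g = h := by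
  rw [← Category.comp_id g, ← hh, ← Category.assoc, hg, Category.id_comp]

lemma isIso_of_square {𝒞 : Type*} [Category* 𝒞] {P P' Q Q' : 𝒞} {p : P ⟶ P'} {q : Q ⟶ Q'}
    (f : P ⟶ Q) (f' : P' ⟶ Q') (_ : IsIso f) (_ : IsIso f') (_ : IsIso p)
    (h : f ≫ q = p ≫ f') : IsIso q := by
  rw [(IsIso.eq_inv_comp f).2 h]
  infer_instance

lemma inv_naturality {X X' Y Y' : B} {a : Mor V X X'} {a' : Mor V X' X} {b : Mor V Y Y'}
    {b' : Mor V Y' Y} {W : V} {p : W ⟶ (X ⟶[V] Y)} {q : W ⟶ (X' ⟶[V] Y')}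
    (ha' : a' ≫ a = 𝟙 (ForgetEnrichment.of V X'))
    (hb : b ≫ b' = 𝟙 (ForgetEnrichment.of V Y))
    (h : p ≫ homPost X b = q ≫ homPre a Y') :
    q ≫ homPost X' b' = p ≫ homPre a' Y := by
  have h1 : q = p ≫ homPost X b ≫ homPre a' Y' := by
    rw [← Category.assoc, h, Category.assoc, ← homPre_comp, ha', homPre_id, Category.comp_id]
  rw [h1, Category.assoc, Category.assoc, ← homPost_homPre, ← Category.assoc (homPost X b),
    ← homPost_comp, hb, homPost_id, Category.id_comp]

lemma triangle_left {𝒞 : Type*} [Category* 𝒞] {𝒟 : Type*} [Category* 𝒟] (K : 𝒞 ⥤ 𝒟)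
    {P Q R S : 𝒞} {u : P ⟶ Q} {v : Q ⟶ R} {e' : R ⟶ S} {e : Q ⟶ P} {n : P ⟶ S}
    {z : K.obj S ⟶ K.obj P} (h₁ : v ≫ e' = e ≫ n) (h₂ : u ≫ e = 𝟙 _)
    (h₃ : K.map n ≫ z = 𝟙 _) : K.map (u ≫ v) ≫ (K.map e' ≫ z) = 𝟙 _ := by
  rw [← Category.assoc, ← K.map_comp, Category.assoc, h₁, ← Category.assoc, h₂,
    Category.id_comp, h₃]

lemma triangle_right {𝒞 : Type*} [Category* 𝒞] {𝒟 : Type*} [Category* 𝒟] (K : 𝒞 ⥤ 𝒟)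
    {P Q R S : 𝒞} {y : K.obj S ⟶ K.obj P} {v : P ⟶ Q} {e' : Q ⟶ R} {e : P ⟶ S} {n : S ⟶ R}
    {z : R ⟶ S} (h₁ : v ≫ e' = e ≫ n) (h₂ : y ≫ K.map e = 𝟙 _)
    (h₃ : n ≫ z = 𝟙 _) : (y ≫ K.map v) ≫ K.map (e' ≫ z) = 𝟙 _ := by
  rw [Category.assoc, ← K.map_comp, ← Category.assoc v, h₁, Category.assoc, h₃,
    Category.comp_id, h₂]

end Homs

section NatTrans

variable {V : Type v} [Category.{w} V] [MonoidalCategory V]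
variable {B : Type u₁} [EnrichedCategory V B] {C : Type u₂} [EnrichedCategory V C]

/-- A `V`-natural transformation `F ⟶ G`: morphisms `app X : F X ⟶ G X` such that
`C(F X, app Y) ∘ F = C(app X, G Y) ∘ G` as morphisms `B(X, Y) ⟶ C(F X, G Y)` of `V`.
(This is stronger than ordinary naturality on the underlying categories.) -/
@[ext]
structure VNatTrans (F G : EnrichedFunctor V B C) where
  app (X : B) : Mor V (F.obj X) (G.obj X)
  naturality (X Y : B) :
    F.map X Y ≫ homPost (F.obj X) (app Y) = G.map X Y ≫ homPre (app X) (G.obj Y)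

lemma VNatTrans.comm {F G : EnrichedFunctor V B C} (α : VNatTrans F G) {X Y : B}
    (f : Mor V X Y) : mapMor F f ≫ α.app Y = α.app X ≫ mapMor G f := by
  have h := congrArg (fun t => el f ≫ t) (α.naturality X Y)
  rw [← Category.assoc, ← Category.assoc, ← el_mapMor, ← el_mapMor, el_homPost, el_homPre] at h
  exact h

/-- A `V`-monad on `B`. -/
structure VMonad (V : Type v) [Category.{w} V] [MonoidalCategory V] (B : Type u₁)
    [EnrichedCategory V B] where
  T : EnrichedFunctor V B B
  η : VNatTrans (EnrichedFunctor.id V B) T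
  μ : VNatTrans (T.comp V T) T
  left_unit (X : B) : η.app (T.obj X) ≫ μ.app X = 𝟙 _
  right_unit (X : B) : mapMor T (η.app X) ≫ μ.app X = 𝟙 _
  assoc (X : B) : mapMor T (μ.app X) ≫ μ.app X = μ.app (T.obj X) ≫ μ.app X

/-- A morphism of `V`-monads `S ⟶ T`. -/
@[ext]
structure VMonad.Hom (S T : VMonad V B) extends VNatTrans S.T T.T where
  unit_app (X : B) : S.η.app X ≫ app X = T.η.app X
  mul_app (X : B) :
    S.μ.app X ≫ app X = (app (S.T.obj X) ≫ mapMor T.T (app X)) ≫ T.μ.app X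

/-- A `V`-monad is idempotent if its multiplication is an isomorphism. -/
def VMonad.IsIdempotent (S : VMonad V B) : Prop :=
  ∀ X : B, IsIso (S.μ.app X)

/-- A `V`-adjunction `F ⊣ G`. -/
structure VAdjunction (F : EnrichedFunctor V B C) (G : EnrichedFunctor V C B) where
  unit : VNatTrans (EnrichedFunctor.id V B) (F.comp V G)
  counit : VNatTrans (G.comp V F) (EnrichedFunctor.id V C)
  left_triangle (X : B) : mapMor F (unit.app X) ≫ counit.app (F.obj X) = 𝟙 _
  right_triangle (Y : C) : unit.app (G.obj Y) ≫ mapMor G (counit.app Y) = 𝟙 _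

namespace VAdjunction

variable {F : EnrichedFunctor V B C} {G : EnrichedFunctor V C B} (adj : VAdjunction F G)

/-- The `V`-monad induced by a `V`-adjunction. -/
def toVMonad : VMonad V B where
  T := F.comp V G
  η := adj.unit
  μ :=
    { app X := mapMor G (adj.counit.app (F.obj X))
      naturality X Y := 
        whisker_naturality G (F.map X Y) (adj.counit.naturality (F.obj X) (F.obj Y))
          (l := (F.map X Y ≫ G.map _ _) ≫ F.map _ _ ≫ G.map _ _) (r := F.map X Y ≫ G.map _ _)
          ((Category.assoc _ _ _).trans
            (congrArg (F.map X Y ≫ ·) (Category.assoc _ _ _).symm))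
          (congrArg (F.map X Y ≫ ·) (Category.id_comp _).symm) }
  left_unit X := adj.right_triangle (F.obj X)
  right_unit X :=
    (congrArg (fun t => t ≫ _) (mapMor_mapMor F G (adj.unit.app X)).symm).trans
    ((G.forget.map_comp _ _).symm.trans
      ((congrArg G.forget.map (adj.left_triangle X)).trans (G.forget.map_id _)))
  assoc X :=
    (congrArg (fun t => t ≫ _) (mapMor_mapMor F G (mapMor G (adj.counit.app (F.obj X)))).symm).trans
    ((congrArg (fun t => G.forget.map t ≫ _)
      (mapMor_mapMor G F (adj.counit.app (F.obj X)))).trans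
    ((G.forget.map_comp _ _).symm.trans
      ((congrArg G.forget.map ((adj.counit.comm (adj.counit.app (F.obj X))).trans
        (congrArg (fun t => _ ≫ t) (mapMor_idFunctor (adj.counit.app (F.obj X)))))).trans
        (G.forget.map_comp _ _))))

variable {D : Type u₃} [EnrichedCategory V D]
variable {F' : EnrichedFunctor V C D} {G' : EnrichedFunctor V D C}

/-- The composite of two `V`-adjunctions. -/
def comp (adj' : VAdjunction F' G') : VAdjunction (F.comp V F') (G'.comp V G) where
  unit :=
    { app X := adj.unit.app X ≫ mapMor G (adj'.unit.app (F.obj X))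
      naturality X Y := comp_naturality (adj.unit.naturality X Y)
        (whisker_naturality G (F.map X Y) (adj'.unit.naturality (F.obj X) (F.obj Y))
          (l := F.map X Y ≫ G.map _ _)
          (r := (F.map X Y ≫ F'.map _ _) ≫ G'.map _ _ ≫ G.map _ _)
          (congrArg (F.map X Y ≫ ·) (Category.id_comp _).symm)
          ((Category.assoc _ _ _).trans
            (congrArg (F.map X Y ≫ ·) (Category.assoc _ _ _).symm))) }
  counit :=
    { app Z := mapMor F' (adj.counit.app (G'.obj Z)) ≫ adj'.counit.app Z
      naturality X Y := comp_naturality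
        (whisker_naturality F' (G'.map X Y) (adj.counit.naturality (G'.obj X) (G'.obj Y))
          (l := (G'.map X Y ≫ G.map _ _) ≫ F.map _ _ ≫ F'.map _ _)
          (r := G'.map X Y ≫ F'.map _ _)
          ((Category.assoc _ _ _).trans
            (congrArg (G'.map X Y ≫ ·) (Category.assoc _ _ _).symm))
          (congrArg (G'.map X Y ≫ ·) (Category.id_comp _).symm))
        (adj'.counit.naturality X Y) }
  left_triangle X :=
    (congrArg (fun t => t ≫ _) (mapMor_mapMor F F' (X := X) (Y := G.obj (G'.obj (F'.obj (F.obj X))))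
      (adj.unit.app X ≫ mapMor G (adj'.unit.app (F.obj X)))).symm).trans
    ((congrArg (fun t => F'.forget.map t ≫ _)
      (F.forget.map_comp (adj.unit.app X) (mapMor G (adj'.unit.app (F.obj X))))).trans
    (triangle_left F'.forget
      ((congrArg (fun t => t ≫ _) (mapMor_mapMor G F (adj'.unit.app (F.obj X)))).trans
        (adj.counit.comm (adj'.unit.app (F.obj X))))
      (adj.left_triangle X)
      ((congrArg (fun t => F'.forget.map t ≫ _)
        (mapMor_idFunctor (adj'.unit.app (F.obj X)))).trans (adj'.left_triangle (F.obj X)))))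
  right_triangle Z :=
    (congrArg (fun t => _ ≫ t) (mapMor_mapMor G' G
      (X := F'.obj (F.obj (G.obj (G'.obj Z)))) (Y := Z)
      (mapMor F' (adj.counit.app (G'.obj Z)) ≫ adj'.counit.app Z)).symm).trans
    ((congrArg (fun t => _ ≫ G.forget.map t)
      (G'.forget.map_comp (mapMor F' (adj.counit.app (G'.obj Z))) (adj'.counit.app Z))).trans
    (triangle_right G.forget
      (((congrArg (fun t => _ ≫ t)
          (mapMor_mapMor F' G' (adj.counit.app (G'.obj Z)))).trans
        (adj'.unit.comm (adj.counit.app (G'.obj Z))).symm).trans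
        (congrArg (fun t => t ≫ _) (mapMor_idFunctor (adj.counit.app (G'.obj Z)))))
      (adj.right_triangle (G'.obj Z))
      (adj'.right_triangle Z)))

/-- An isomorphism between two `V`-adjunctions: invertible `V`-natural transformations
between the left and between the right adjoints that are compatible with units and counits. -/
structure Iso {F₁ F₂ : EnrichedFunctor V B C} {G₁ G₂ : EnrichedFunctor V C B}
    (adj₁ : VAdjunction F₁ G₁) (adj₂ : VAdjunction F₂ G₂) where
  φ : VNatTrans F₁ F₂
  ψ : VNatTrans G₁ G₂
  isIso_φ (X : B) : IsIso (φ.app X)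
  isIso_ψ (Y : C) : IsIso (ψ.app Y)
  unit_comp (X : B) :
    adj₁.unit.app X ≫ mapMor G₁ (φ.app X) ≫ ψ.app (F₂.obj X) = adj₂.unit.app X
  comp_counit (Y : C) :
    (mapMor F₁ (ψ.app Y) ≫ φ.app (G₂.obj Y)) ≫ adj₂.counit.app Y = adj₁.counit.app Y

end VAdjunction

/-- The objects of the full sub-`V`-category of `B` determined by a class of objects. -/
structure FullSub (V : Type v) [Category.{w} V] [MonoidalCategory V] {B : Type u₁}
    [EnrichedCategory V B] (P : ObjectProperty (ForgetEnrichment V B)) where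
  obj : B
  property : P (ForgetEnrichment.of V obj)

instance (P : ObjectProperty (ForgetEnrichment V B)) : EnrichedCategory V (FullSub V P) where
  Hom X Y := X.obj ⟶[V] Y.obj
  id X := eId V X.obj
  comp X Y Z := eComp V X.obj Y.obj Z.obj
  id_comp X Y := e_id_comp V X.obj Y.obj
  comp_id X Y := e_comp_id V X.obj Y.obj
  assoc W X Y Z := e_assoc V W.obj X.obj Y.obj Z.obj

/-- The inclusion `V`-functor of a full sub-`V`-category. -/
def incl (P : ObjectProperty (ForgetEnrichment V B)) : EnrichedFunctor V (FullSub V P) B where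
  obj X := X.obj
  map X Y := 𝟙 (X.obj ⟶[V] Y.obj)
  map_id _ := Category.comp_id _
  map_comp X Y Z := (Category.comp_id _).trans
    ((congrArg (fun t => t ≫ eComp V X.obj Y.obj Z.obj)
      (id_tensorHom_id (X.obj ⟶[V] Y.obj) (Y.obj ⟶[V] Z.obj))).trans (Category.id_comp _)).symm

lemma mapMor_incl {P : ObjectProperty (ForgetEnrichment V B)} {X Y : FullSub V P}
    (f : Mor V X Y) : mapMor (incl P) f = (show Mor V X.obj Y.obj from f) :=
  Category.comp_id (el f)

/-- A `V`-reflection on `B`: a replete full sub-`V`-category whose inclusion has a left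
`V`-adjoint. -/
structure VReflection (V : Type v) [Category.{w} V] [MonoidalCategory V] (B : Type u₁)
    [EnrichedCategory V B] where
  P : ObjectProperty (ForgetEnrichment V B)
  replete : P.IsClosedUnderIsomorphisms
  K : EnrichedFunctor V B (FullSub V P)
  adj : VAdjunction K (incl P)

namespace VMonad

lemma IsIdempotent.map_η {S : VMonad V B} (h : S.IsIdempotent) (X : B) :
    mapMor S.T (S.η.app X) = S.η.app (S.T.obj X) := by
  have := h X
  exact (cancel_mono (S.μ.app X)).1 ((S.right_unit X).trans (S.left_unit X).symm)

lemma IsIdempotent.isIso_η {S : VMonad V B} (h : S.IsIdempotent) (X : B) :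
    IsIso (S.η.app (S.T.obj X)) := by
  exact isIso_of_comp_eq_id (S.left_unit X) (h X)

/-- The class of objects `X` of `B` for which the unit component `X ⟶ S X` is invertible. -/
def fixed (S : VMonad V B) : ObjectProperty (ForgetEnrichment V B) :=
  fun X => IsIso (S.η.app (ForgetEnrichment.to V X))

/-- The left adjoint `X ↦ S X` of the inclusion of the full sub-`V`-category of objects fixed
by an idempotent `V`-monad `S`. -/
def reflector (S : VMonad V B) (h : S.IsIdempotent) :
    EnrichedFunctor V B (FullSub V S.fixed) where
  obj X := ⟨S.T.obj X, h.isIso_η X⟩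
  map X Y := S.T.map X Y
  map_id X := S.T.map_id X
  map_comp X Y Z := S.T.map_comp X Y Z

/-- The inverse of the unit component at a fixed object. -/
noncomputable def unitInv (S : VMonad V B) (X : FullSub V S.fixed) :
    Mor V (S.T.obj X.obj) X.obj :=
  @inv _ _ _ _ (S.η.app X.obj) X.property

lemma η_unitInv (S : VMonad V B) (X : FullSub V S.fixed) :
    S.η.app X.obj ≫ S.unitInv X = 𝟙 _ :=
  @IsIso.hom_inv_id _ _ _ _ (S.η.app X.obj) X.property

lemma unitInv_η (S : VMonad V B) (X : FullSub V S.fixed) :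
    S.unitInv X ≫ S.η.app X.obj = 𝟙 _ :=
  @IsIso.inv_hom_id _ _ _ _ (S.η.app X.obj) X.property

/-- The `V`-reflection determined by an idempotent `V`-monad `S`: the reflective subcategory
consists of the objects `X` for which the unit `X ⟶ S X` is invertible. -/
noncomputable def reflection (S : VMonad V B) (h : S.IsIdempotent) : VReflection V B where
  P := S.fixed
  replete := ⟨fun {X Y} e hX =>
    isIso_of_square e.hom (S.T.forget.map e.hom) e.isIso_hom (S.T.forget.mapIso e).isIso_hom hX
      ((congrArg (fun t => t ≫ _)
        (mapMor_idFunctor (X := ForgetEnrichment.to V X) (Y := ForgetEnrichment.to V Y)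
          e.hom).symm).trans
        (S.η.comm (X := ForgetEnrichment.to V X) (Y := ForgetEnrichment.to V Y) e.hom))⟩
  K := S.reflector h
  adj :=
    { unit :=
        { app X := S.η.app X
          naturality X Y := (S.η.naturality X Y).trans
            (congrArg (fun t => t ≫ homPre (S.η.app X) (S.T.obj Y))
              (Category.comp_id (S.T.map X Y)).symm) }
      counit :=
        { app X := S.unitInv X
          naturality X Y := inv_naturality (unitInv_η S X) (η_unitInv S Y)
            ((S.η.naturality X.obj Y.obj).trans
              (congrArg (fun t => t ≫ homPre (S.η.app X.obj) (S.T.obj Y.obj))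
                (Category.id_comp (S.T.map X.obj Y.obj)).symm)) }
      left_triangle X :=
        (congrArg (fun t => t ≫ S.unitInv ⟨S.T.obj X, h.isIso_η X⟩) (h.map_η X)).trans
          (η_unitInv S ⟨S.T.obj X, h.isIso_η X⟩)
      right_triangle X :=
        (congrArg (fun t => S.η.app X.obj ≫ t)
          (mapMor_incl (X := ⟨S.T.obj X.obj, h.isIso_η X.obj⟩) (Y := X) (S.unitInv X))).trans
          (η_unitInv S X) }

lemma eq_of_heq {S T : VMonad V B} (h : S.T = T.T)
    (hη : ∀ X, HEq (S.η.app X) (T.η.app X)) (hμ : ∀ X, HEq (S.μ.app X) (T.μ.app X)) :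
    S = T := by
  obtain ⟨S, η, μ, _, _, _⟩ := S
  obtain ⟨T, η', μ', _, _, _⟩ := T
  obtain rfl : S = T := h
  obtain rfl : η = η' := VNatTrans.ext (funext fun X => _root_.eq_of_heq (hη X))
  obtain rfl : μ = μ' := VNatTrans.ext (funext fun X => _root_.eq_of_heq (hμ X))
  rfl

/-- The `V`-reflection determined by an idempotent `V`-monad induces that `V`-monad. -/
lemma reflection_toVMonad (S : VMonad V B) (h : S.IsIdempotent) :
    (S.reflection h).adj.toVMonad = S :=
  eq_of_heq
    (EnrichedFunctor.ext V (fun _ => rfl) (fun X Y => by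
      change (S.T.map X Y ≫ 𝟙 (S.T.obj X ⟶[V] S.T.obj Y)) ≫ 𝟙 (S.T.obj X ⟶[V] S.T.obj Y) =
        S.T.map X Y
      simp))
    (fun _ => HEq.rfl)
    (fun X => heq_of_eq ((mapMor_incl (X := ⟨S.T.obj (S.T.obj X), h.isIso_η (S.T.obj X)⟩)
        (Y := ⟨S.T.obj X, h.isIso_η X⟩) (S.unitInv ⟨S.T.obj X, h.isIso_η X⟩)).trans
      (eq_of_comp_eq_id (unitInv_η S ⟨S.T.obj X, h.isIso_η X⟩) (S.left_unit X))))

end VMonad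

namespace VAdjunction

variable {F : EnrichedFunctor V B C} {G : EnrichedFunctor V C B} (adj : VAdjunction F G)
  (R : VReflection V B)

/-- A `V`-adjunction `F ⊣ G` factors through a `V`-reflection `K ⊣ J : B' ↪ B` if the image
of `G` lies in `B'`.  One then has the adjunction `F' ⊣ G'` between `B'` and `C` given by
`inducedAdj` below, and the composite of `K ⊣ J` and `F' ⊣ G'` is isomorphic to `F ⊣ G`. -/
def FactorsThrough (_ : VAdjunction F G) (R : VReflection V B) : Prop :=
  ∀ Y : C, R.P (ForgetEnrichment.of V (G.obj Y))

variable {R}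

/-- The induced left adjoint `F' = F J : B' ⟶ C`. -/
def inducedLeft (F : EnrichedFunctor V B C) (R : VReflection V B) :
    EnrichedFunctor V (FullSub V R.P) C :=
  (incl R.P).comp V F

/-- The induced right adjoint `G' : C ⟶ B'`, the corestriction of `G`. -/
def inducedRight (h : adj.FactorsThrough R) : EnrichedFunctor V C (FullSub V R.P) where
  obj Y := ⟨G.obj Y, h Y⟩
  map X Y := G.map X Y
  map_id X := G.map_id X
  map_comp X Y Z := G.map_comp X Y Z

/-- `J G' = G`. -/
lemma inducedRight_comp_incl (h : adj.FactorsThrough R) :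
    (adj.inducedRight h).comp V (incl R.P) = G :=
  EnrichedFunctor.ext V (fun _ => rfl) (fun X Y => by
    change (G.map X Y ≫ 𝟙 (G.obj X ⟶[V] G.obj Y)) ≫ 𝟙 (G.obj X ⟶[V] G.obj Y) = G.map X Y
    simp)

/-- The induced adjunction `F' ⊣ G'`, with the same unit and counit components as `F ⊣ G`. -/
def inducedAdj (h : adj.FactorsThrough R) :
    VAdjunction (inducedLeft F R) (adj.inducedRight h) where
  unit :=
    { app X := adj.unit.app X.obj
      naturality X Y := (adj.unit.naturality X.obj Y.obj).trans
        (congrArg (fun t => (t ≫ G.map (F.obj X.obj) (F.obj Y.obj)) ≫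
            homPre (adj.unit.app X.obj) (G.obj (F.obj Y.obj)))
          (Category.id_comp (F.map X.obj Y.obj)).symm) }
  counit :=
    { app Y := adj.counit.app Y
      naturality X Y := (congrArg (fun t => (G.map X Y ≫ t) ≫
            homPost (F.obj (G.obj X)) (adj.counit.app Y))
          (Category.id_comp (F.map (G.obj X) (G.obj Y)))).trans
        (adj.counit.naturality X Y) }
  left_triangle X :=
    (congrArg (fun t => t ≫ adj.counit.app (F.obj X.obj))
      (congrArg (fun t => el (adj.unit.app X.obj) ≫ t)
        (Category.id_comp (F.map X.obj (G.obj (F.obj X.obj)))))).trans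
      (adj.left_triangle X.obj)
  right_triangle Y := adj.right_triangle Y

end VAdjunction

end NatTrans

section Orthogonality

variable {V : Type v} [Category.{w} V] [MonoidalCategory V]
variable {B : Type u₁} [EnrichedCategory V B] {C : Type u₂} [EnrichedCategory V C]

/-- `e` is `V`-orthogonal to `m`: the square of hom-objects
`B(A₂,B₁) ⟶ B(A₂,B₂)`, `B(A₁,B₁) ⟶ B(A₁,B₂)` is a pullback in `V`. -/
def VOrth {A₁ A₂ B₁ B₂ : B} (e : Mor V A₁ A₂) (m : Mor V B₁ B₂) : Prop :=
  IsPullback (homPost A₂ m) (homPre e B₁) (homPre e B₂) (homPost A₁ m)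

/-- The class of morphisms `m` such that every `e` in `W` is `V`-orthogonal to `m`. -/
def rightOrth (W : MorphismProperty (ForgetEnrichment V B)) :
    MorphismProperty (ForgetEnrichment V B) :=
  fun _ _ m => ∀ (A₁ A₂ : B) (e : Mor V A₁ A₂), W e → VOrth e m

/-- The class of morphisms `e` that are `V`-orthogonal to every `m` in `W`. -/
def leftOrth (W : MorphismProperty (ForgetEnrichment V B)) :
    MorphismProperty (ForgetEnrichment V B) :=
  fun _ _ e => ∀ (B₁ B₂ : B) (m : Mor V B₁ B₂), W m → VOrth e m

/-- `V`-monomorphisms. -/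
def VMono : MorphismProperty (ForgetEnrichment V B) :=
  fun _ _ m => ∀ A : B, Mono (homPost A m)

/-- `V`-epimorphisms, that is, `V`-monomorphisms in the opposite `V`-category. -/
def VEpi : MorphismProperty (ForgetEnrichment V B) :=
  fun _ _ e => ∀ A : B, Mono (homPre e A)

/-- `V`-prefactorization systems. -/
structure IsVPrefactorizationSystem (E M : MorphismProperty (ForgetEnrichment V B)) : Prop where
  rightOrth_eq : rightOrth E = M
  leftOrth_eq : leftOrth M = E

/-- `V`-factorization systems. -/
structure IsVFactorizationSystem (E M : MorphismProperty (ForgetEnrichment V B)) : Prop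
    extends IsVPrefactorizationSystem E M where
  factors : E.HasFactorization M

/-- `V`-properness of a pair of classes of morphisms. -/
structure IsVProper (E M : MorphismProperty (ForgetEnrichment V B)) : Prop where
  left_le : E ≤ VEpi
  right_le : M ≤ VMono

/-- The class `Σ_F` of morphisms inverted by a `V`-functor `F`. -/
def inverted (F : EnrichedFunctor V B C) : MorphismProperty (ForgetEnrichment V B) :=
  (MorphismProperty.isomorphisms (ForgetEnrichment V C)).inverseImage F.forget

/-- The class of objects to which every morphism in `W` is `V`-orthogonal:
`B(f, X)` is an isomorphism in `V` for every `f` in `W`. -/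
def orthObj (W : MorphismProperty (ForgetEnrichment V B)) :
    ObjectProperty (ForgetEnrichment V B) :=
  fun X => ∀ (A₁ A₂ : B) (f : Mor V A₁ A₂), W f → IsIso (homPre f (ForgetEnrichment.to V X))

/-- `T`-complete objects. -/
def TComplete (T : VMonad V B) : ObjectProperty (ForgetEnrichment V B) :=
  orthObj (inverted T.T)

/-- `T`-separated objects: the unit component is an `M`-embedding. -/
def TSeparated (T : VMonad V B) (M : MorphismProperty (ForgetEnrichment V B)) :
    ObjectProperty (ForgetEnrichment V B) :=
  fun X => M (T.η.app (ForgetEnrichment.to V X))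

/-- `T`-closed `M`-embeddings. -/
def TClosedEmb (T : VMonad V B) (M : MorphismProperty (ForgetEnrichment V B)) :
    MorphismProperty (ForgetEnrichment V B) :=
  rightOrth (inverted T.T) ⊓ M

/-- `T`-dense morphisms. -/
def TDense (T : VMonad V B) (M : MorphismProperty (ForgetEnrichment V B)) :
    MorphismProperty (ForgetEnrichment V B) :=
  leftOrth (TClosedEmb T M)

/-- `S` is an idempotent `V`-core of `T`: it is an idempotent `V`-monad whose underlying
endofunctor inverts the same morphisms as that of `T`. -/
structure IsIdempotentCore (S T : VMonad V B) : Prop where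
  idempotent : S.IsIdempotent
  inverted_eq : inverted S.T = inverted T.T

end Orthogonality

end VCat

/-!
Write `Σ` for the class of morphisms inverted by `T`. Three observations carry the proof.

* An object whose unit `X ⟶ T X` has a retraction is complete, because `B(f, X)` is then a retract
  of `B(T f, X)` (`tComplete_of_retraction`). This covers all `T X`, and all `G Y` for an
  adjunction `F ⊣ G` inducing `T`. Any morphism between complete objects lies in the right
  orthogonal of `Σ`, so it is a closed embedding as soon as it lies in `M`.

* If the unit at `X` factors as `e ≫ m` with `m ≫ T e` the unit at the middle object `Y`, then
  `T e` is invertible (`VMonad.isIso_mapMor_of_unit_factorization`). The condition is automatic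
  when `e` is an epimorphism. Applied to the `(E, M)`-factorization of the unit at a complete
  object, this makes the `E`-part an isomorphism, whence complete objects are separated
  (`tSeparated_of_tComplete`).

* The same criterion applies when `e` is dense and `m` is a closed embedding
  (`isIso_mapMor_of_dense_closed`). Here `T e` is a split monomorphism between complete objects,
  so it is itself a closed embedding, and the density of `e` yields a diagonal of the naturality
  square of the unit at `e`. Cancelling `T e` shows that this diagonal is `m`, so that `m ≫ T e` is
  the unit at `Y`.

Hence the dense-closed factorization of the unit at `X` gives a morphism of `Σ` from `X` to a
complete object, which determines an idempotent `V`-monad (`OrthReflection.toVMonad`) with the same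
inverted morphisms. For an arbitrary core `S`, the unit of `S` lies in `Σ` and `S X` is complete, so
the comparison `ι : S ⟶ T` is forced by the universal property of `S X`; it satisfies
`ι ≫ T ρ = η` at `S X`, where `ρ` and `η` are the units of `S` and `T`. As `T ρ` is invertible and
`S X` is separated, `ι` is a closed embedding. Finally, an adjunction `F ⊣ G` inducing `T` has `F`
inverting exactly `Σ`, and a morphism of `Σ` between complete objects is an isomorphism, which makes
the restriction of `F` conservative.
-/

namespace VCat

/-! ### Morphisms and hom-objects -/

section Homs

variable {V : Type v} [Category.{w} V] [MonoidalCategory V]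
variable {B : Type u₁} [EnrichedCategory V B]

lemma el_injective {X Y : B} : Function.Injective (el (V := V) (X := X) (Y := Y)) :=
  fun _ _ h => h

lemma el_id (X : B) : el (𝟙 (ForgetEnrichment.of V X)) = eId V X :=
  ForgetEnrichment.homTo_id V (ForgetEnrichment.of V X)

lemma isIso_homPost (A : B) {X Y : B} (g : Mor V X Y) [IsIso g] : IsIso (homPost A g) :=
  ⟨homPost A (inv g), by
    rw [← homPost_comp, IsIso.hom_inv_id, homPost_id], by
    rw [← homPost_comp, IsIso.inv_hom_id, homPost_id]⟩

lemma isIso_homPre (A : B) {X Y : B} (f : Mor V X Y) [IsIso f] : IsIso (homPre f A) :=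
  ⟨homPre (inv f) A, by
    rw [← homPre_comp, IsIso.inv_hom_id, homPre_id], by
    rw [← homPre_comp, IsIso.hom_inv_id, homPre_id]⟩

lemma eComp_homPre {X X' : B} (f : Mor V X X') (Y Z : B) :
    eComp V X' Y Z ≫ homPre f Z = homPre f Y ▷ _ ≫ eComp V X Y Z :=
  eComp_eHomWhiskerRight V f (ForgetEnrichment.of V Y) (ForgetEnrichment.of V Z)

lemma eComp_homPost (X Y : B) {Z Z' : B} (g : Mor V Z Z') :
    eComp V X Y Z ≫ homPost X g = _ ◁ homPost Y g ≫ eComp V X Y Z' :=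
  eComp_eHomWhiskerLeft V (ForgetEnrichment.of V X) (ForgetEnrichment.of V Y) g

lemma homPost_whiskerRight_eComp (X : B) {Y Y' : B} (g : Mor V Y Y') (Z : B) :
    homPost X g ▷ _ ≫ eComp V X Y' Z = _ ◁ homPre g Z ≫ eComp V X Y Z := by
  simp only [homPost, homPre, comp_whiskerRight, MonoidalCategory.whiskerLeft_comp,
    Category.assoc]
  rw [← e_assoc', associator_naturality_middle_assoc, triangle_assoc_comp_right_inv_assoc]

lemma hom_ext_of_mono_homPre {X Y Z : B} {e : Mor V X Y} (he : Mono (homPre e Z))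
    {g h : Mor V Y Z} (hgh : e ≫ g = e ≫ h) : g = h := by
  apply el_injective
  rw [← cancel_mono (homPre e Z), el_homPre, el_homPre, hgh]

/-- A `V`-epimorphism is an epimorphism of the underlying category. -/
lemma epi_of_vEpi {X Y : B} {e : Mor V X Y} (he : VEpi e) : Epi e where
  left_cancellation {Z} _ _ hgh :=
    hom_ext_of_mono_homPre (Z := ForgetEnrichment.to V Z) (he (ForgetEnrichment.to V Z)) hgh

/-! ### Orthogonality -/

lemma VOrth.of_isIso_homPost {A₁ A₂ X Y : B} {e : Mor V A₁ A₂} {m : Mor V X Y}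
    (h₁ : IsIso (homPost A₁ m)) (h₂ : IsIso (homPost A₂ m)) : VOrth e m :=
  IsPullback.of_horiz_isIso ⟨homPost_homPre e m⟩

lemma VOrth.of_isIso_homPre {A₁ A₂ X Y : B} {e : Mor V A₁ A₂} {m : Mor V X Y}
    (h₁ : IsIso (homPre e X)) (h₂ : IsIso (homPre e Y)) : VOrth e m :=
  IsPullback.of_vert_isIso ⟨homPost_homPre e m⟩

lemma VOrth.isIso_homPre {A₁ A₂ X Y : B} {e : Mor V A₁ A₂} {m : Mor V X Y}
    (h : VOrth e m) (hY : IsIso (homPre e Y)) : IsIso (homPre e X) :=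
  IsPullback.isIso_snd_of_isIso h

lemma VOrth.comp {A₁ A₂ X Y Z : B} {e : Mor V A₁ A₂} {m : Mor V X Y} {n : Mor V Y Z}
    (hm : VOrth e m) (hn : VOrth e n) : VOrth (B₁ := X) (B₂ := Z) e (m ≫ n) := by
  have h := IsPullback.paste_horiz hm hn
  rwa [← homPost_comp, ← homPost_comp] at h

lemma rightOrth_of_isIso (W : MorphismProperty (ForgetEnrichment V B)) {X Y : B}
    (m : Mor V X Y) [IsIso m] : rightOrth W m :=
  fun A₁ A₂ _ _ => VOrth.of_isIso_homPost (isIso_homPost A₁ m) (isIso_homPost A₂ m)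

lemma rightOrth_comp {W : MorphismProperty (ForgetEnrichment V B)} {X Y Z : B}
    {m : Mor V X Y} {n : Mor V Y Z} (hm : rightOrth W m) (hn : rightOrth W n) :
    rightOrth W (m ≫ n) :=
  fun A₁ A₂ e he => VOrth.comp (hm A₁ A₂ e he) (hn A₁ A₂ e he)

/-- Orthogonality provides diagonal fillers in the underlying category. -/
lemma VOrth.exists_lift {A₁ A₂ B₁ B₂ : B} {e : Mor V A₁ A₂} {m : Mor V B₁ B₂} (h : VOrth e m)
    (u : Mor V A₁ B₁) (v : Mor V A₂ B₂) (huv : u ≫ m = e ≫ v) :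
    ∃ d : Mor V A₂ B₁, e ≫ d = u ∧ d ≫ m = v := by
  have w : el v ≫ homPre e B₂ = el u ≫ homPost A₁ m := by
    rw [el_homPre, el_homPost, huv]
  refine ⟨ForgetEnrichment.homOf V (h.lift (el v) (el u) w), el_injective ?_, el_injective ?_⟩
  · rw [← el_homPre]
    exact h.lift_snd _ _ w
  · rw [← el_homPost]
    exact h.lift_fst _ _ w

variable {W : MorphismProperty (ForgetEnrichment V B)}

lemma rightOrth_of_orthObj {X Y : B} (hX : orthObj W (ForgetEnrichment.of V X))
    (hY : orthObj W (ForgetEnrichment.of V Y)) (m : Mor V X Y) : rightOrth W m :=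
  fun A₁ A₂ e he => VOrth.of_isIso_homPre (hX A₁ A₂ e he) (hY A₁ A₂ e he)

lemma orthObj_of_rightOrth {X Y : B} (hY : orthObj W (ForgetEnrichment.of V Y))
    {m : Mor V X Y} (hm : rightOrth W m) : orthObj W (ForgetEnrichment.of V X) :=
  fun A₁ A₂ e he => VOrth.isIso_homPre (hm A₁ A₂ e he) (hY A₁ A₂ e he)

/-- Morphisms to an object orthogonal to `f` are determined by their restriction along `f`. -/
lemma orthObj.hom_ext {X A₁ A₂ : B} (hX : orthObj W (ForgetEnrichment.of V X))
    {f : Mor V A₁ A₂} (hf : W f) {g h : Mor V A₂ X} (hgh : f ≫ g = f ≫ h) : g = h := by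
  have : IsIso (homPre f X) := hX A₁ A₂ f hf
  exact hom_ext_of_mono_homPre inferInstance hgh

/-- A morphism to an object orthogonal to `f` extends along `f`. -/
lemma orthObj.exists_extension {X A₁ A₂ : B} (hX : orthObj W (ForgetEnrichment.of V X))
    {f : Mor V A₁ A₂} (hf : W f) (g : Mor V A₁ X) : ∃ h : Mor V A₂ X, f ≫ h = g := by
  have : IsIso (homPre f X) := hX A₁ A₂ f hf
  refine ⟨ForgetEnrichment.homOf V (el g ≫ inv (homPre f X)), el_injective ?_⟩
  rw [← el_homPre]
  exact (Category.assoc _ _ _).trans (by rw [IsIso.inv_hom_id, Category.comp_id])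

lemma isIso_of_orthObj {X Y : B} (hX : orthObj W (ForgetEnrichment.of V X))
    (hY : orthObj W (ForgetEnrichment.of V Y)) {f : Mor V X Y} (hf : W f) : IsIso f := by
  obtain ⟨r, hr⟩ := orthObj.exists_extension hX hf (𝟙 _)
  exact ⟨r, hr, orthObj.hom_ext hY hf (by
    rw [← Category.assoc, hr, Category.id_comp, Category.comp_id])⟩

end Homs

section Monads

variable {V : Type v} [Category.{w} V] [MonoidalCategory V]
variable {B : Type u₁} [EnrichedCategory V B] {C : Type u₂} [EnrichedCategory V C]

/-! ### Underlying adjunctions -/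

/-- The adjunction between the underlying ordinary categories. -/
def VAdjunction.toAdjunction {F : EnrichedFunctor V B C} {G : EnrichedFunctor V C B}
    (adj : VAdjunction F G) : F.forget ⊣ G.forget :=
  Adjunction.mkOfUnitCounit
    { unit :=
        { app X := adj.unit.app X
          naturality X Y f :=
            (congrArg (· ≫ adj.unit.app Y) (mapMor_idFunctor (X := X) (Y := Y) f)).symm.trans
              ((adj.unit.comm (X := X) (Y := Y) f).trans (congrArg (adj.unit.app X ≫ ·)
                (mapMor_mapMor F G (X := X) (Y := Y) f).symm)) }
      counit :=
        { app X := adj.counit.app X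
          naturality X Y f :=
            (congrArg (· ≫ adj.counit.app Y) (mapMor_mapMor G F (X := X) (Y := Y) f)).trans
              ((adj.counit.comm (X := X) (Y := Y) f).trans (congrArg (adj.counit.app X ≫ ·)
                (mapMor_idFunctor (X := X) (Y := Y) f))) }
      left_triangle := by
        ext X
        exact (congrArg (_ ≫ ·) (Category.id_comp _)).trans (adj.left_triangle X)
      right_triangle := by
        ext X
        exact (congrArg (_ ≫ ·) (Category.id_comp _)).trans (adj.right_triangle X) }

/-- If `f` is sent to an isomorphism by `G F`, then `F` already inverts it. -/
lemma isIso_map_left_of_isIso {𝒞 𝒟 : Type*} [Category* 𝒞] [Category* 𝒟] {F : 𝒞 ⥤ 𝒟} {G : 𝒟 ⥤ 𝒞}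
    (adj : F ⊣ G) {X Y : 𝒞} (f : X ⟶ Y) [IsIso (G.map (F.map f))] : IsIso (F.map f) := by
  refine ⟨F.map (adj.unit.app Y ≫ inv (G.map (F.map f))) ≫ adj.counit.app (F.obj X), ?_, ?_⟩
  · have := adj.unit.naturality f
    dsimp at this
    rw [← F.map_comp_assoc, ← Category.assoc, this, Category.assoc, IsIso.hom_inv_id,
      Category.comp_id, adj.left_triangle_components]
  · rw [Category.assoc, ← adj.counit_naturality, ← F.map_comp_assoc]
    simp

/-! ### Morphisms inverted by a `V`-monad -/

namespace VMonad

variable (T : VMonad V B)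

/-- The unit component, as a morphism out of `X` itself. -/
def unit (X : B) : Mor V X (T.T.obj X) := T.η.app X

lemma unit_naturality (X Y : B) :
    T.T.map X Y ≫ homPre (T.unit X) (T.T.obj Y) = homPost X (T.unit Y) :=
  (T.η.naturality X Y).symm.trans (Category.id_comp _)

lemma unit_comm {X Y : B} (f : Mor V X Y) :
    f ≫ T.unit Y = T.unit X ≫ mapMor T.T f :=
  (congrArg (· ≫ T.η.app Y) (mapMor_idFunctor f)).symm.trans (T.η.comm f)

/-- The multiplication component, as a morphism out of `T (T X)`. -/
def mul (X : B) : Mor V (T.T.obj (T.T.obj X)) (T.T.obj X) := T.μ.app X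

lemma unit_mul (X : B) : T.unit (T.T.obj X) ≫ T.mul X = 𝟙 _ := T.left_unit X

lemma map_unit_mul (X : B) : mapMor T.T (T.unit X) ≫ T.mul X = 𝟙 _ := T.right_unit X

lemma mul_comm {X Y : B} (f : Mor V X Y) :
    mapMor T.T (mapMor T.T f) ≫ T.mul Y = T.mul X ≫ mapMor T.T f :=
  (congrArg (· ≫ T.μ.app Y) (mapMor_mapMor T.T T.T f)).trans (T.μ.comm f)

/-- If the unit at `X` factors as `e ≫ m` and `m ≫ T e` is the unit at `Y`, then `T e` is
invertible: its inverse is the extension `T m ≫ μ` of `m`. -/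
lemma isIso_mapMor_of_unit_factorization {X Y : B} {e : Mor V X Y} {m : Mor V Y (T.T.obj X)}
    (h : e ≫ m = T.unit X) (h' : m ≫ mapMor T.T e = T.unit Y) : IsIso (mapMor T.T e) :=
  ⟨mapMor T.T m ≫ T.mul X, by
    rw [← Category.assoc, ← mapMor_comp, h, map_unit_mul], by
    rw [Category.assoc, ← mul_comm, ← Category.assoc, ← mapMor_comp, h', map_unit_mul]⟩

/-- If the unit at `X` factors through an epimorphism `e`, then `T e` is invertible. -/
lemma isIso_mapMor_of_epi {X Y : B} {e : Mor V X Y} {m : Mor V Y (T.T.obj X)}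
    (he : Epi e) (h : e ≫ m = T.unit X) : IsIso (mapMor T.T e) :=
  T.isIso_mapMor_of_unit_factorization h
    (he.left_cancellation _ _ (by rw [← Category.assoc, h, unit_comm]))

end VMonad

/-! ### Complete objects -/

/-- An object with a retraction of its unit is complete, since `B(f, X)` is then a retract of
`B(T f, X)`. -/
lemma tComplete_of_retraction (T : VMonad V B) {X : B} {a : Mor V (T.T.obj X) X}
    (ha : T.unit X ≫ a = 𝟙 (ForgetEnrichment.of V X)) :
    TComplete T (ForgetEnrichment.of V X) := fun A₁ A₂ f hf => by
  change IsIso (homPre f X)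
  have : IsIso (mapMor T.T f) := hf
  have := isIso_homPre X (mapMor T.T f)
  -- `B(A, X)` is a retract of `B(T A, X)`; the next two facts say that it is so naturally in `A`
  have key (A : B) : T.T.map A X ≫ homPost (T.T.obj A) a ≫ homPre (T.unit A) X = 𝟙 _ := by
    rw [homPost_homPre, ← Category.assoc, T.unit_naturality, ← homPost_comp, ha, homPost_id]
  have hin : homPre f X ≫ T.T.map A₁ X ≫ homPost (T.T.obj A₁) a =
      T.T.map A₂ X ≫ homPost (T.T.obj A₂) a ≫ homPre (mapMor T.T f) X := by
    rw [← Category.assoc, ← map_homPre, Category.assoc, homPost_homPre]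
  have hout : homPre (T.unit A₂) X ≫ homPre f X =
      homPre (mapMor T.T f) X ≫ homPre (T.unit A₁) X := by
    rw [← homPre_comp, ← homPre_comp, T.unit_comm]
  refine ⟨T.T.map A₁ X ≫ homPost (T.T.obj A₁) a ≫ inv (homPre (mapMor T.T f) X) ≫
    homPre (T.unit A₂) X, ?_, ?_⟩
  · have h := congrArg (· ≫ inv (homPre (mapMor T.T f) X) ≫ homPre (T.unit A₂) X) hin
    simpa [key] using h
  · simp [hout, key]

lemma tComplete_obj (T : VMonad V B) (X : B) :
    TComplete T (ForgetEnrichment.of V (T.T.obj X)) :=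
  tComplete_of_retraction T (T.unit_mul X)

/-! ### The reflection determined by a choice of arrows into orthogonal objects -/

section Reflection

/-- The data of a reflection onto the objects orthogonal to `W`: for every `X` a morphism of `W`
from `X` to an object orthogonal to `W`. -/
structure OrthReflection (V : Type v) [Category.{w} V] [MonoidalCategory V] {B : Type u₁}
    [EnrichedCategory V B] (W : MorphismProperty (ForgetEnrichment V B)) where
  obj (X : B) : B
  unit (X : B) : Mor V X (obj X)
  unit_mem (X : B) : W (unit X)
  orthObj_obj (X : B) : orthObj W (ForgetEnrichment.of V (obj X))

namespace OrthReflection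

variable {W : MorphismProperty (ForgetEnrichment V B)} (R : OrthReflection V W)

instance isIso_homPre_unit (X Y : B) : IsIso (homPre (R.unit X) (R.obj Y)) :=
  R.orthObj_obj Y _ _ _ (R.unit_mem X)

instance isIso_unit_obj (X : B) : IsIso (R.unit (R.obj X)) :=
  isIso_of_orthObj (R.orthObj_obj X) (R.orthObj_obj (R.obj X)) (R.unit_mem (R.obj X))

/-- The endofunctor `X ↦ R X`; on hom-objects it is
`B(X, Y) ⟶ B(X, R Y) ≅ B(R X, R Y)`. -/
noncomputable def functor : EnrichedFunctor V B B where
  obj := R.obj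
  map X Y := homPost X (R.unit Y) ≫ inv (homPre (R.unit X) (R.obj Y))
  map_id X := by
    have h : eId V X ≫ homPost X (R.unit X) =
        eId V (R.obj X) ≫ homPre (R.unit X) (R.obj X) := by
      rw [← el_id, ← el_id]
      exact (el_homPost (𝟙 (ForgetEnrichment.of V X)) (R.unit X)).trans
        (((congrArg el (Category.id_comp (R.unit X))).trans
          (congrArg el (Category.comp_id (R.unit X)).symm)).trans
        (el_homPre (R.unit X) (𝟙 (ForgetEnrichment.of V (R.obj X)))).symm)
    rw [← Category.assoc, h, Category.assoc, IsIso.hom_inv_id, Category.comp_id]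
  map_comp X Y Z := by
    -- after restriction along the unit at `X` both sides are composition followed by the unit at
    -- `Z`, since the unit at `Y` can be moved across composition
    rw [← cancel_mono (homPre (R.unit X) (R.obj Z))]
    simp only [Category.assoc, IsIso.inv_hom_id, Category.comp_id, eComp_homPre, eComp_homPost]
    rw [MonoidalCategory.tensorHom_def'_assoc, ← comp_whiskerRight_assoc]
    simp only [Category.assoc, IsIso.inv_hom_id, Category.comp_id]
    rw [homPost_whiskerRight_eComp, ← MonoidalCategory.whiskerLeft_comp_assoc]
    simp

lemma functor_map_homPre_unit (X Y : B) :
    R.functor.map X Y ≫ homPre (R.unit X) (R.obj Y) = homPost X (R.unit Y) :=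
  (Category.assoc _ _ _).trans ((congrArg (homPost X (R.unit Y) ≫ ·)
    (IsIso.inv_hom_id (homPre (R.unit X) (R.obj Y)))).trans (Category.comp_id _))

/-- The unit of the reflection as a `V`-natural transformation. -/
noncomputable def η : VNatTrans (EnrichedFunctor.id V B) R.functor where
  app X := R.unit X
  naturality X Y := (Category.id_comp _).trans (R.functor_map_homPre_unit X Y).symm

lemma unit_comm {X Y : B} (f : Mor V X Y) :
    f ≫ R.unit Y = R.unit X ≫ mapMor R.functor f :=
  (congrArg (· ≫ R.unit Y) (mapMor_idFunctor f)).symm.trans (R.η.comm f)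

/-- The inverse of the unit at `R X`. -/
noncomputable def mul (X : B) : Mor V (R.obj (R.obj X)) (R.obj X) :=
  inv (R.unit (R.obj X))

lemma unit_mul (X : B) : R.unit (R.obj X) ≫ R.mul X = 𝟙 _ :=
  IsIso.hom_inv_id (R.unit (R.obj X))

lemma mul_unit (X : B) : R.mul X ≫ R.unit (R.obj X) = 𝟙 _ :=
  IsIso.inv_hom_id (R.unit (R.obj X))

/-- The pointed endofunctor of the reflection is well-pointed. -/
lemma map_unit (X : B) : mapMor R.functor (R.unit X) = R.unit (R.obj X) :=
  orthObj.hom_ext (R.orthObj_obj (R.obj X)) (R.unit_mem X) (R.unit_comm (R.unit X)).symm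

lemma map_mul (X : B) : mapMor R.functor (R.mul X) = R.mul (R.obj X) :=
  orthObj.hom_ext (R.orthObj_obj (R.obj X)) (R.unit_mem (R.obj (R.obj X)))
    (((R.unit_comm (R.mul X)).symm.trans (R.mul_unit X)).trans (R.unit_mul (R.obj X)).symm)

/-- The idempotent `V`-monad of the reflection. -/
noncomputable def toVMonad : VMonad V B where
  T := R.functor
  η := R.η
  μ :=
    { app X := R.mul X
      naturality X Y := inv_naturality (R.mul_unit X) (R.unit_mul Y)
        ((congrArg (R.functor.map X Y ≫ ·)
          (R.functor_map_homPre_unit (R.obj X) (R.obj Y))).symm.trans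
            (Category.assoc _ _ _).symm) }
  left_unit X := R.unit_mul X
  right_unit X := (congrArg (· ≫ R.mul X) (R.map_unit X)).trans (R.unit_mul X)
  assoc X := congrArg (· ≫ R.mul X) (R.map_mul X)

lemma toVMonad_isIdempotent : R.toVMonad.IsIdempotent := fun X =>
  ⟨R.unit (R.obj X), R.mul_unit X, R.unit_mul X⟩

end OrthReflection

end Reflection

end Monads

section Core

variable {V : Type v} [Category.{w} V] [MonoidalCategory V]
variable {B : Type u₁} [EnrichedCategory V B] {C : Type u₂} [EnrichedCategory V C]

/-! ### Complete objects and idempotent cores -/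

instance (F : EnrichedFunctor V B C) : (inverted F).HasTwoOutOfThreeProperty :=
  inferInstanceAs ((MorphismProperty.isomorphisms
    (ForgetEnrichment V C)).inverseImage F.forget).HasTwoOutOfThreeProperty

/-- A reflection onto the `T`-complete objects with unit in `Σ_T` gives an idempotent core. -/
lemma OrthReflection.isIdempotentCore {T : VMonad V B} (R : OrthReflection V (inverted T.T)) :
    IsIdempotentCore R.toVMonad T where
  idempotent := R.toVMonad_isIdempotent
  inverted_eq := by
    ext X Y f
    have h : f ≫ R.unit Y = R.unit X ≫ mapMor R.functor f := R.unit_comm f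
    have hR : inverted T.T (f ≫ R.unit Y) ↔ inverted T.T (R.unit X ≫ mapMor R.functor f) :=
      iff_of_eq (congrArg (inverted T.T (X := X) (Y := R.obj Y)) h)
    constructor
    · intro hf
      have hRf : inverted T.T (mapMor R.functor f) := by
        have : IsIso (mapMor R.functor f) := hf
        exact inferInstanceAs (IsIso (T.T.forget.map (mapMor R.functor f)))
      refine (inverted T.T).of_postcomp _ (R.unit Y) (R.unit_mem Y) (hR.2 ?_)
      exact (inverted T.T).comp_mem _ _ (R.unit_mem X) hRf
    · intro hf
      refine isIso_of_orthObj (R.orthObj_obj X) (R.orthObj_obj Y)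
        ((inverted T.T).of_precomp (R.unit X) _ (R.unit_mem X) (hR.1 ?_))
      exact (inverted T.T).comp_mem _ _ hf (R.unit_mem Y)

namespace IsIdempotentCore

variable {S T : VMonad V B}

lemma unit_mem (hS : IsIdempotentCore S T) (X : B) : inverted T.T (S.unit X) := by
  rw [← hS.inverted_eq]
  have h := hS.idempotent.isIso_η X
  rwa [← hS.idempotent.map_η X] at h

lemma tComplete_eq (hS : IsIdempotentCore S T) : TComplete S = TComplete T :=
  congrArg orthObj hS.inverted_eq

lemma tComplete_obj (hS : IsIdempotentCore S T) (X : B) :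
    TComplete T (ForgetEnrichment.of V (S.T.obj X)) := by
  rw [← hS.tComplete_eq]
  exact VCat.tComplete_obj S X

/-- The objects fixed by an idempotent core are the complete ones. -/
lemma fixed_eq (hS : IsIdempotentCore S T) : S.fixed = TComplete T := by
  ext X
  constructor
  · intro hX
    rw [← hS.tComplete_eq]
    exact tComplete_of_retraction (X := X) S (S.η_unitInv ⟨X, hX⟩)
  · intro hX
    exact isIso_of_orthObj (X := X) hX (hS.tComplete_obj X) (hS.unit_mem X)

/-- The extension `S X ⟶ T X` of the unit of `T` along the unit of `S`. -/
noncomputable def homApp (hS : IsIdempotentCore S T) (X : B) : Mor V (S.T.obj X) (T.T.obj X) :=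
  ((VCat.tComplete_obj T X).exists_extension (hS.unit_mem X) (T.unit X)).choose

lemma unit_homApp (hS : IsIdempotentCore S T) (X : B) : S.unit X ≫ hS.homApp X = T.unit X :=
  ((VCat.tComplete_obj T X).exists_extension (hS.unit_mem X) (T.unit X)).choose_spec

/-- The comparison `S X ⟶ T X` is the unit of `T` at `S X` followed by the inverse of the
isomorphism `T X ⟶ T (S X)`. -/
lemma homApp_mapMor_unit (hS : IsIdempotentCore S T) (X : B) :
    hS.homApp X ≫ mapMor T.T (S.unit X) = T.unit (S.T.obj X) :=
  (VCat.tComplete_obj T (S.T.obj X)).hom_ext (hS.unit_mem X) (by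
    rw [← Category.assoc, unit_homApp, VMonad.unit_comm])

/-- The comparison morphism from an idempotent core; its `V`-naturality and compatibility with
multiplication are checked after restriction along the unit of `S`. -/
noncomputable def hom (hS : IsIdempotentCore S T) : VMonad.Hom S T where
  app X := hS.homApp X
  naturality X Y := by
    have : IsIso (homPre (S.unit X) (T.T.obj Y)) := VCat.tComplete_obj T Y _ _ _ (hS.unit_mem X)
    rw [← cancel_mono (homPre (S.unit X) (T.T.obj Y)), Category.assoc, homPost_homPre,
      ← Category.assoc, S.unit_naturality, Category.assoc, ← homPre_comp, ← homPost_comp,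
      unit_homApp]
    exact (T.unit_naturality X Y).symm.trans (congrArg
      (fun t => T.T.map X Y ≫ homPre t (T.T.obj Y))
      (hS.unit_homApp X).symm)
  unit_app X := hS.unit_homApp X
  mul_app X := by
    refine (VCat.tComplete_obj T X).hom_ext (hS.unit_mem (S.T.obj X)) ?_
    change S.unit (S.T.obj X) ≫ S.mul X ≫ hS.homApp X = S.unit (S.T.obj X) ≫
      (hS.homApp (S.T.obj X) ≫ mapMor T.T (hS.homApp X)) ≫ T.mul X
    rw [← Category.assoc, S.unit_mul, Category.id_comp, ← Category.assoc, ← Category.assoc,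
      unit_homApp, ← T.unit_comm, Category.assoc, T.unit_mul, Category.comp_id]

lemma hom_unique (hS : IsIdempotentCore S T) (ι : VMonad.Hom S T) : ι = hS.hom :=
  VMonad.Hom.ext (funext fun X => (VCat.tComplete_obj T X).hom_ext (hS.unit_mem X)
    ((ι.unit_app X).trans (hS.unit_homApp X).symm))

end IsIdempotentCore

/-! ### Consequences of the factorization systems -/

variable {T : VMonad V B} {E M : MorphismProperty (ForgetEnrichment V B)}

lemma inverted_le_tDense : inverted T.T ≤ TDense T M :=
  fun _ _ e he _ _ _ hm => hm.1 _ _ e he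

lemma exists_factorization {P Q : MorphismProperty (ForgetEnrichment V B)}
    (h : P.HasFactorization Q) {X Y : B} (f : Mor V X Y) :
    ∃ (Z : B) (i : Mor V X Z) (p : Mor V Z Y), i ≫ p = f ∧ P i ∧ Q p := by
  obtain ⟨d⟩ := h.nonempty_mapFactorizationData f
  exact ⟨d.Z, d.i, d.p, d.fac, d.hi, d.hp⟩

lemma IsVPrefactorizationSystem.right_comp (hEM : IsVPrefactorizationSystem E M) {X Y Z : B}
    {m : Mor V X Y} {n : Mor V Y Z} (hm : M m) (hn : M n) : M (m ≫ n) := by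
  rw [← hEM.rightOrth_eq] at hm hn ⊢
  exact rightOrth_comp hm hn

lemma IsVPrefactorizationSystem.right_of_isIso (hEM : IsVPrefactorizationSystem E M) {X Y : B}
    (m : Mor V X Y) [IsIso m] : M m := by
  rw [← hEM.rightOrth_eq]
  exact rightOrth_of_isIso E m

/-- Split monomorphisms belong to `M`: the `E`-part of a factorization is an epimorphism and a
split monomorphism. -/
lemma right_of_retraction (hEM : IsVFactorizationSystem E M) (hE : E ≤ VEpi) {X Y : B}
    {m : Mor V X Y} {r : Mor V Y X} (h : m ≫ r = 𝟙 _) : M m := by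
  obtain ⟨Z, e, n, rfl, he, hn⟩ := exists_factorization hEM.factors m
  have : Epi e := epi_of_vEpi (hE _ he)
  have : IsSplitMono e := ⟨⟨n ≫ r, by rw [← Category.assoc, h]⟩⟩
  have := isIso_of_epi_of_isSplitMono e
  exact hEM.right_comp (hEM.right_of_isIso e) hn

lemma tSeparated_of_tComplete (hEM : IsVFactorizationSystem E M) (hE : E ≤ VEpi) {X : B}
    (hX : TComplete T (ForgetEnrichment.of V X)) : M (T.unit X) := by
  obtain ⟨Z, e, m, h, he, hm⟩ := exists_factorization hEM.factors (T.unit X)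
  have he' : Epi e := epi_of_vEpi (hE _ he)
  have hTe : inverted T.T e := T.isIso_mapMor_of_epi he' h
  -- as `X` is complete, the identity of `X` extends along `e`
  obtain ⟨r, hr⟩ := hX.exists_extension hTe (𝟙 _)
  have : IsSplitMono e := ⟨⟨r, hr⟩⟩
  have := isIso_of_epi_of_isSplitMono e
  rw [← h]
  exact hEM.right_comp (hEM.right_of_isIso e) hm

/-- If the unit at `X` factors as a dense morphism `e` followed by a closed embedding `m`, then
`T e` is invertible. -/
lemma isIso_mapMor_of_dense_closed (hEM : IsVFactorizationSystem E M) (hE : E ≤ VEpi) {X Y : B}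
    {e : Mor V X Y} {m : Mor V Y (T.T.obj X)} (he : TDense T M e) (hm : TClosedEmb T M m)
    (h : e ≫ m = T.unit X) : IsIso (mapMor T.T e) := by
  have hTe : mapMor T.T e ≫ mapMor T.T m ≫ T.mul X = 𝟙 _ := by
    rw [← Category.assoc, ← mapMor_comp, h, T.map_unit_mul]
  -- `T e` is a split monomorphism between complete objects, hence a closed embedding
  have hcl : TClosedEmb T M (mapMor T.T e) :=
    ⟨rightOrth_of_orthObj (tComplete_obj T X) (tComplete_obj T Y) _,
      right_of_retraction hEM hE hTe⟩
  obtain ⟨d, -, hd⟩ := VOrth.exists_lift (B := B) (he _ _ (mapMor T.T e) hcl) (T.unit X)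
    (T.unit Y) (T.unit_comm e).symm
  -- cancelling the split monomorphism `T e` identifies the diagonal with `m`
  have hdm : d = m := calc
    d = d ≫ mapMor T.T e ≫ mapMor T.T m ≫ T.mul X := by rw [hTe, Category.comp_id]
    _ = (m ≫ T.unit (T.T.obj X)) ≫ T.mul X := by
      rw [← Category.assoc, hd, ← Category.assoc, ← T.unit_comm]
    _ = m := by rw [Category.assoc, T.unit_mul, Category.comp_id]
  subst hdm
  exact T.isIso_mapMor_of_unit_factorization h hd

/-- The reflection of `X` is the middle object of the dense-closed factorization of the unit at
`X`: it is complete since it is closed in `T X`. -/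
lemma exists_isIdempotentCore (hEM : IsVFactorizationSystem E M) (hE : E ≤ VEpi)
    (hfac : (TDense T M).HasFactorization (TClosedEmb T M)) :
    ∃ S : VMonad V B, IsIdempotentCore S T := by
  have key (X : B) : ∃ (Y : B) (e : Mor V X Y), inverted T.T e ∧
      TComplete T (ForgetEnrichment.of V Y) := by
    obtain ⟨Z, e, m, h, he, hm⟩ := exists_factorization hfac (T.unit X)
    exact ⟨Z, e, isIso_mapMor_of_dense_closed hEM hE he hm h,
      orthObj_of_rightOrth (tComplete_obj T X) hm.1⟩
  choose obj unit unit_mem complete using key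
  exact ⟨_, OrthReflection.isIdempotentCore ⟨obj, unit, unit_mem, complete⟩⟩

lemma IsIdempotentCore.tClosedEmb_hom (hEM : IsVFactorizationSystem E M) (hE : E ≤ VEpi)
    {S : VMonad V B} (hS : IsIdempotentCore S T) (X : B) : TClosedEmb T M (hS.hom.app X) := by
  refine ⟨rightOrth_of_orthObj (hS.tComplete_obj X) (VCat.tComplete_obj T X) _, ?_⟩
  have : IsIso (mapMor T.T (S.unit X)) := hS.unit_mem X
  have h : hS.homApp X = T.unit (S.T.obj X) ≫ inv (mapMor T.T (S.unit X)) := by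
    rw [IsIso.eq_comp_inv, homApp_mapMor_unit]
  change M (hS.homApp X)
  rw [h]
  exact hEM.right_comp (tSeparated_of_tComplete hEM hE (hS.tComplete_obj X))
    (hEM.right_of_isIso _)

/-! ### Factorization of adjunctions -/

section Adjunction

variable {F : EnrichedFunctor V B C} {G : EnrichedFunctor V C B} (adj : VAdjunction F G)
  {S : VMonad V B}

lemma factorsThrough_reflection (hS : IsIdempotentCore S adj.toVMonad) :
    adj.FactorsThrough (S.reflection hS.idempotent) := fun Y => by
  change S.fixed _
  rw [hS.fixed_eq]
  exact tComplete_of_retraction adj.toVMonad (adj.right_triangle Y)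

lemma mapMor_inducedLeft (R : VReflection V B) {X Y : FullSub V R.P} (f : Mor V X Y) :
    mapMor (VAdjunction.inducedLeft F R) f =
      mapMor F (show Mor V X.obj Y.obj from f) :=
  congrArg (el f ≫ ·) (Category.id_comp (F.map X.obj Y.obj))

/-- `F` inverts the same morphisms as the monad it induces. -/
lemma inverted_toVMonad_iff {X Y : B} {f : Mor V X Y} :
    inverted adj.toVMonad.T f ↔ inverted F f := by
  change IsIso (mapMor (F.comp V G) f) ↔ IsIso (mapMor F f)
  rw [← mapMor_mapMor]
  constructor
  · intro h
    have : IsIso (G.forget.map (F.forget.map f)) := h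
    exact isIso_map_left_of_isIso adj.toAdjunction f
  · intro h
    exact inferInstanceAs (IsIso (G.forget.map (mapMor F f)))

lemma isIso_mapMor_unit (hS : IsIdempotentCore S adj.toVMonad) (X : B) :
    IsIso (mapMor F (S.unit X)) :=
  (inverted_toVMonad_iff adj).1 (hS.unit_mem X)

lemma reflectsIsomorphisms_inducedLeft (hS : IsIdempotentCore S adj.toVMonad) :
    (VAdjunction.inducedLeft F (S.reflection hS.idempotent)).forget.ReflectsIsomorphisms where
  reflects {X Y} f hf := by
    have key : ∀ (X Y : FullSub V S.fixed) (f : Mor V X.obj Y.obj), IsIso (mapMor F f) →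
        IsIso f := fun X Y f hf => by
      have hle := hS.fixed_eq.le
      exact isIso_of_orthObj (hle _ X.property) (hle _ Y.property)
        ((inverted_toVMonad_iff adj).2 hf)
    -- composition in the full sub-`V`-category is that of `B`, so an inverse in `B` is one there
    obtain ⟨g, h₁, h₂⟩ := key X Y f (by
      rw [← mapMor_inducedLeft (S.reflection hS.idempotent) (X := X) (Y := Y) f]
      exact hf)
    exact ⟨g, h₁, h₂⟩

/-- The inverse of `F` applied to the unit of the core. -/
noncomputable def mapUnitInv (hS : IsIdempotentCore S adj.toVMonad) (X : B) :
    Mor V (F.obj (S.T.obj X)) (F.obj X) :=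
  have := isIso_mapMor_unit adj hS X
  inv (mapMor F (S.unit X))

lemma mapMor_unit_mapUnitInv (hS : IsIdempotentCore S adj.toVMonad) (X : B) :
    mapMor F (S.unit X) ≫ mapUnitInv adj hS X = 𝟙 _ :=
  have := isIso_mapMor_unit adj hS X
  IsIso.hom_inv_id (mapMor F (S.unit X))

lemma mapUnitInv_mapMor_unit (hS : IsIdempotentCore S adj.toVMonad) (X : B) :
    mapUnitInv adj hS X ≫ mapMor F (S.unit X) = 𝟙 _ :=
  have := isIso_mapMor_unit adj hS X
  IsIso.inv_hom_id (mapMor F (S.unit X))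

lemma unit_comp_mapUnitInv (hS : IsIdempotentCore S adj.toVMonad) (X : B) :
    (S.unit X ≫ adj.toVMonad.unit (S.T.obj X)) ≫ mapMor G (mapUnitInv adj hS X) =
      adj.toVMonad.unit X := by
  have h : S.unit X ≫ adj.toVMonad.unit (S.T.obj X) =
      adj.toVMonad.unit X ≫ mapMor G (mapMor F (S.unit X)) :=
    (adj.toVMonad.unit_comm (S.unit X)).trans
      (congrArg (adj.toVMonad.unit X ≫ ·) (mapMor_mapMor F G (S.unit X)).symm)
  refine (congrArg (· ≫ mapMor G (mapUnitInv adj hS X)) h).trans ((Category.assoc _ _ _).trans ?_)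
  refine (congrArg (adj.toVMonad.unit X ≫ ·) ?_).trans (Category.comp_id _)
  exact (mapMor_comp G _ _).symm.trans
    ((congrArg (mapMor G) (mapMor_unit_mapUnitInv adj hS X)).trans (mapMor_id G (F.obj X)))

/-- At a fixed object the counit of the reflection is the inverse of the unit, so both
constructions of an inverse agree. -/
lemma mapUnitInv_eq (hS : IsIdempotentCore S adj.toVMonad) (X : FullSub V S.fixed) :
    mapUnitInv adj hS X.obj = mapMor F (S.unitInv X) :=
  eq_of_comp_eq_id (mapUnitInv_mapMor_unit adj hS X.obj) (by
    rw [← mapMor_comp]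
    exact (congrArg (mapMor F) (S.η_unitInv X)).trans (mapMor_id F X.obj))

lemma mapMor_unit_naturality (F : EnrichedFunctor V B C) (S : VMonad V B) (X Y : B) :
    F.map X Y ≫ homPost (F.obj X) (mapMor F (S.unit Y)) =
      (S.T.map X Y ≫ F.map (S.T.obj X) (S.T.obj Y)) ≫
        homPre (mapMor F (S.unit X)) (F.obj (S.T.obj Y)) := by
  rw [map_homPost, ← S.unit_naturality, Category.assoc, Category.assoc, map_homPre]

/-- The composite of the reflection and the induced adjunction is the given one, up to the
isomorphism of left adjoints inverse to `F` applied to the unit of the core. -/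
lemma nonempty_iso_comp_inducedAdj (hS : IsIdempotentCore S adj.toVMonad)
    (h : adj.FactorsThrough (S.reflection hS.idempotent)) :
    Nonempty (VAdjunction.Iso
      ((S.reflection hS.idempotent).adj.comp (adj.inducedAdj h)) adj) :=
  ⟨{ φ :=
      { app X := mapUnitInv adj hS X
        naturality X Y := by
          refine inv_naturality (mapUnitInv_mapMor_unit adj hS X)
            (mapMor_unit_mapUnitInv adj hS Y) ?_
          exact (mapMor_unit_naturality F S X Y).trans
            (congrArg (fun t => (S.T.map X Y ≫ t) ≫
              homPre (mapMor F (S.unit X)) (F.obj (S.T.obj Y)))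
                (Category.id_comp (F.map (S.T.obj X) (S.T.obj Y))).symm) }
     ψ :=
      { app Y := 𝟙 (ForgetEnrichment.of V (G.obj Y))
        naturality X Y := by
          refine (congrArg (_ ≫ ·) (homPost_id _ _)).trans
            (Eq.trans ?_ (congrArg (_ ≫ ·) (homPre_id _ _)).symm)
          exact congrArg (· ≫ 𝟙 _) (Category.comp_id (G.map X Y)) }
     isIso_φ X := ⟨mapMor F (S.unit X), mapUnitInv_mapMor_unit adj hS X,
      mapMor_unit_mapUnitInv adj hS X⟩
     isIso_ψ Y := IsIso.id (ForgetEnrichment.of V (G.obj Y))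
     unit_comp X := by
      have h₁ : mapMor (incl S.fixed) (X := ⟨S.T.obj X, hS.idempotent.isIso_η X⟩)
          (Y := (adj.inducedRight h).obj (F.obj (S.T.obj X))) (adj.unit.app (S.T.obj X)) =
          adj.unit.app (S.T.obj X) := mapMor_incl _
      have h₂ : mapMor ((adj.inducedRight h).comp V (incl S.fixed)) (mapUnitInv adj hS X) =
          mapMor G (mapUnitInv adj hS X) :=
        congrArg (el (mapUnitInv adj hS X) ≫ ·) (Category.comp_id _)
      refine (congrArg (_ ≫ ·) (Category.comp_id _)).trans ?_
      refine (congrArg (_ ≫ ·) h₂).trans ?_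
      refine (congrArg (fun t => (S.unit X ≫ t) ≫ mapMor G (mapUnitInv adj hS X)) h₁).trans ?_
      exact unit_comp_mapUnitInv adj hS X
     comp_counit Y := by
      have h₁ : mapMor (VAdjunction.inducedLeft F (S.reflection hS.idempotent))
          (X := (S.reflection hS.idempotent).K.obj (G.obj Y)) (Y := ⟨G.obj Y, h Y⟩)
          (S.unitInv ⟨G.obj Y, h Y⟩) = mapUnitInv adj hS (G.obj Y) :=
        (mapMor_inducedLeft (S.reflection hS.idempotent)
          (X := (S.reflection hS.idempotent).K.obj (G.obj Y)) (Y := ⟨G.obj Y, h Y⟩) _).trans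
          (mapUnitInv_eq adj hS ⟨G.obj Y, h Y⟩).symm
      refine Eq.trans ?_ (congrArg (· ≫ adj.counit.app Y) h₁).symm
      refine congrArg (· ≫ adj.counit.app Y) ?_
      exact (congrArg (· ≫ mapUnitInv adj hS (G.obj Y)) (mapMor_id _ (G.obj Y))).trans
        (Category.id_comp _) }⟩

end Adjunction

end Core

end VCat

theorem mainTheorem1 {V : Type v} [Category.{w} V] [MonoidalCategory V] [SymmetricCategory V]
    [MonoidalClosed V] {B : Type u₁} [EnrichedCategory V B] (T : VCat.VMonad V B)
    (E M : MorphismProperty (ForgetEnrichment V B))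
    (hEM : VCat.IsVFactorizationSystem E M) (hproper : VCat.IsVProper E M)
    (hfac : (VCat.TDense T M).HasFactorization (VCat.TClosedEmb T M)) :
    -- an idempotent `V`-core exists
    (∃ S : VCat.VMonad V B, VCat.IsIdempotentCore S T) ∧
    -- every `T`-complete object is `T`-separated
    (∀ X, VCat.TComplete T X → VCat.TSeparated T M X) ∧
    ∀ (S : VCat.VMonad V B) (hS : VCat.IsIdempotentCore S T),
      -- the reflective subcategory determined by the core consists of the `T`-complete objects
      (S.reflection hS.idempotent).P = VCat.TComplete T ∧
      -- the unique monad morphism to `T` has `T`-closed `M`-embeddings as components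
      (∃ ι : VCat.VMonad.Hom S T, (∀ ι' : VCat.VMonad.Hom S T, ι' = ι) ∧
        ∀ X : B, VCat.TClosedEmb T M (ι.app X)) ∧
      -- the unit of the core has `T`-dense components
      (∀ X : B, VCat.TDense T M (S.η.app X)) ∧
      -- every `V`-adjunction inducing `T` factors through the reflection determined by the core,
      -- with conservative induced left adjoint
      ∀ (C : Type u₂) [EnrichedCategory V C] (F : EnrichedFunctor V B C)
        (G : EnrichedFunctor V C B) (adj : VCat.VAdjunction F G), adj.toVMonad = T →
        ∃ h : adj.FactorsThrough (S.reflection hS.idempotent),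
          Nonempty (VCat.VAdjunction.Iso
            ((S.reflection hS.idempotent).adj.comp (adj.inducedAdj h)) adj) ∧
          (VCat.VAdjunction.inducedLeft F
            (S.reflection hS.idempotent)).forget.ReflectsIsomorphisms := by
  have hE := hproper.left_le
  refine ⟨VCat.exists_isIdempotentCore hEM hE hfac,
    fun X hX => VCat.tSeparated_of_tComplete (X := X) hEM hE hX, fun S hS => ⟨hS.fixed_eq,
      ⟨hS.hom, hS.hom_unique, hS.tClosedEmb_hom hEM hE⟩,
      fun X => VCat.inverted_le_tDense _ (hS.unit_mem X), ?_⟩⟩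
  rintro C _ F G adj rfl
  exact ⟨VCat.factorsThrough_reflection adj hS, VCat.nonempty_iso_comp_inducedAdj adj hS _,
    VCat.reflectsIsomorphisms_inducedLeft adj hS⟩
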